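/- Let $(Z,d)$ be a nonempty compact metric space, let $2\le m<\infty$, and let $f_1,\dots,f_m: Z\to Z$ be contractions in the following sense: for each $j$ there is a function $\alpha_j:(0,\infty)\to(0,1)$ with $\inf_{\eta>0}\alpha_j(\eta)>0$ such that, for every $\eta>0$ and all $z,z'\in Z$, $$d(z,z')<\eta \implies d(f_j(z),f_j(z'))\le \alpha_j(\eta)\,d(z,z').$$ Then there exists a nonempty compact set $X\subset Z$ with $\bigcup_{j=1}^m f_j(X)=X$, and $X$ is the only nonempty compact subset of $Z$ with this property. If moreover (i) each $f_j$ is one-to-one, and (ii) the set $\bigcup_{j=1}^m\{z\in Z : f_j(z)=z\}$ is not a singleton, then $X$, with the subspace topology, is perfect, i.e. no singleton $\{p\}$, $p\in X$, is open in $X$. If, in addition to (i) and (ii), (iii) $\displaystyle\sum_{j=1}^m\inf_{\eta>0}\alpha_j(\eta)<1$, then $X$ is also zero-dimensional: for every $p\in X$ and every open subset $U$ of $X$ containing $p$ there is a subset $u$ of $X$, both open and closed in $X$, with $p\in u\subset U$. -/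

import Mathlib

/-- A topological space is zero-dimensional if every point of every open set `U` has a
clopen neighbourhood contained in `U`. -/
def IsZeroDimensional (Y : Type*) [TopologicalSpace Y] : Prop :=
  ∀ p : Y, ∀ U : Set Y, IsOpen U → p ∈ U → ∃ u : Set Y, IsClopen u ∧ p ∈ u ∧ u ⊆ U

/-- `X` is an attractor of the system `f`: a nonempty compact set with `⋃ j, f j (X) = X`. -/
def IsSelfSimilarCompact {Z : Type*} [TopologicalSpace Z] {m : ℕ} (f : Fin m → Z → Z)
    (X : Set Z) : Prop :=
  X.Nonempty ∧ IsCompact X ∧ ⋃ j, f j '' X = X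

open Filter Topology MeasureTheory

section IteratedFunctionSystem

variable {Z : Type*} [MetricSpace Z] {m : ℕ} {f : Fin m → Z → Z} {K : NNReal}

/-! At a scale exceeding the diameter of `Z`, all the maps contract by a common `K < 1`. Each point
of an attractor is `g y`, with `g` an `n`-fold composition of the maps, and moving `y` moves it by
at most `K ^ n` times the diameter. Moving `y` into another attractor gives uniqueness; moving it
within `X`, with `g` injective, gives perfectness. For zero-dimensionality, the infima are nearly
attained, so below some scale the Lipschitz constants sum to less than `1`. Refining a fine cover
then drives its total diameter to zero. Distances from a point of `X` thus form a null set, and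
balls of omitted radii are clopen. -/

/-- A nonempty closed set invariant under a contraction contains its fixed point. -/
theorem ContractingWith.fixedPoint_mem_of_isClosed [CompleteSpace Z] [Nonempty Z] {g : Z → Z}
    (hg : ContractingWith K g) {C : Set Z} (hC : IsClosed C) (hne : C.Nonempty)
    (hmap : Set.MapsTo g C C) : hg.fixedPoint g ∈ C := by
  obtain ⟨x, hx⟩ := hne
  exact hC.mem_of_tendsto (hg.tendsto_iterate_fixedPoint x)
    (Eventually.of_forall fun n => hmap.iterate n hx)

/-- Existence of the attractor: the intersection of all nonempty closed invariant sets. -/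
theorem exists_isSelfSimilarCompact [CompactSpace Z] [Nonempty Z] (j₀ : Fin m)
    (hf : ∀ j, ContractingWith K (f j)) : ∃ X : Set Z, IsSelfSimilarCompact f X := by
  let 𝒞 : Set (Set Z) := {C | IsClosed C ∧ C.Nonempty ∧ ∀ j, Set.MapsTo (f j) C C}
  have hcl : IsClosed (⋂₀ 𝒞) := isClosed_sInter fun C hC => hC.1
  have hne : (⋂₀ 𝒞).Nonempty :=
    ⟨(hf j₀).fixedPoint (f j₀), fun C hC =>
      (hf j₀).fixedPoint_mem_of_isClosed hC.1 hC.2.1 (hC.2.2 j₀)⟩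
  have hmap : ∀ j, Set.MapsTo (f j) (⋂₀ 𝒞) (⋂₀ 𝒞) := fun j x hx C hC => hC.2.2 j (hx C hC)
  have hsub : ⋃ j, f j '' ⋂₀ 𝒞 ⊆ ⋂₀ 𝒞 := Set.iUnion_subset fun j => (hmap j).image_subset
  -- The union of images itself belongs to `𝒞`, so it contains the intersection.
  refine ⟨⋂₀ 𝒞, hne, hcl.isCompact, hsub.antisymm (Set.sInter_subset_of_mem ⟨?_, ?_, ?_⟩)⟩
  · exact isClosed_iUnion_of_finite fun j =>
      (hcl.isCompact.image (hf j).toLipschitzWith.continuous).isClosed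
  · exact (hne.image (f j₀)).mono (Set.subset_iUnion (fun j => f j '' ⋂₀ 𝒞) j₀)
  · exact fun j x hx => Set.mem_iUnion.2 ⟨j, Set.mem_image_of_mem _ (hsub hx)⟩

theorem IsSelfSimilarCompact.mapsTo {X : Set Z} (hX : IsSelfSimilarCompact f X) (j : Fin m) :
    Set.MapsTo (f j) X X := fun x hx => by
  rw [← hX.2.2]
  exact Set.mem_iUnion.2 ⟨j, Set.mem_image_of_mem _ hx⟩

/-- Every point of the attractor lies in the image of the attractor under some `n`-fold
composition of the maps. -/
theorem IsSelfSimilarCompact.exists_composition {X : Set Z} (hX : IsSelfSimilarCompact f X)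
    (hf : ∀ j, LipschitzWith K (f j)) (n : ℕ) {x : Z} (hx : x ∈ X) :
    ∃ g : Z → Z, LipschitzWith (K ^ n) g ∧ ((∀ j, Function.Injective (f j)) → g.Injective) ∧
      (∀ Y : Set Z, (∀ j, Set.MapsTo (f j) Y Y) → Set.MapsTo g Y Y) ∧ ∃ y ∈ X, g y = x := by
  induction n generalizing x with
  | zero =>
    exact ⟨id, by simpa using LipschitzWith.id, fun _ => Function.injective_id,
      fun Y _ => Set.mapsTo_id Y, x, hx, rfl⟩
  | succ n ih =>
    have hx' := hx
    rw [← hX.2.2] at hx'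
    obtain ⟨j, y, hy, rfl⟩ := Set.mem_iUnion.1 hx'
    obtain ⟨g, hg, hinj, hmap, z, hz, rfl⟩ := ih hy
    refine ⟨f j ∘ g, ?_, fun h => (h j).comp (hinj h), fun Y hY => (hY j).comp (hmap Y hY),
      z, hz, rfl⟩
    rw [pow_succ']
    exact (hf j).comp hg

theorem exists_pow_mul_lt (hK : K < 1) (D : ℝ) {ε : ℝ} (hε : 0 < ε) :
    ∃ n : ℕ, ((K ^ n : NNReal) : ℝ) * D < ε := by
  have h : Tendsto (fun n : ℕ => ((K ^ n : NNReal) : ℝ) * D) atTop (𝓝 (0 * D)) := by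
    simp only [NNReal.coe_pow]
    exact (tendsto_pow_atTop_nhds_zero_of_lt_one K.2 (by exact_mod_cast hK)).mul_const D
  rw [zero_mul] at h
  exact (h.eventually_lt_const hε).exists

theorem LipschitzWith.dist_le_mul_diam_univ [CompactSpace Z] {C : NNReal} {g : Z → Z}
    (hg : LipschitzWith C g) (x y : Z) :
    dist (g x) (g y) ≤ C * Metric.diam (Set.univ : Set Z) :=
  (hg.dist_le_mul x y).trans <| mul_le_mul_of_nonneg_left
    (Metric.dist_le_diam_of_mem isCompact_univ.isBounded trivial trivial) C.2

theorem IsSelfSimilarCompact.subset [CompactSpace Z] {X Y : Set Z}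
    (hX : IsSelfSimilarCompact f X) (hY : IsSelfSimilarCompact f Y)
    (hf : ∀ j, ContractingWith K (f j)) (hK : K < 1) : X ⊆ Y := by
  intro x hx
  rw [← hY.2.1.isClosed.closure_eq, Metric.mem_closure_iff]
  intro ε hε
  obtain ⟨n, hn⟩ := exists_pow_mul_lt hK (Metric.diam (Set.univ : Set Z)) hε
  obtain ⟨g, hg, -, hmap, y, -, rfl⟩ :=
    hX.exists_composition (fun j => (hf j).toLipschitzWith) n hx
  obtain ⟨z, hz⟩ := hY.1
  exact ⟨g z, hmap Y hY.mapsTo hz, (hg.dist_le_mul_diam_univ y z).trans_lt hn⟩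

/-- The attractor of an injective system is perfect as soon as it has two points. -/
theorem IsSelfSimilarCompact.perfectSpace [CompactSpace Z] {X : Set Z}
    (hX : IsSelfSimilarCompact f X) (hnt : X.Nontrivial)
    (hf : ∀ j, ContractingWith K (f j)) (hK : K < 1) (hinj : ∀ j, Function.Injective (f j)) :
    PerfectSpace X := by
  rw [perfectSpace_iff_forall_not_isolated]
  rintro ⟨x, hx⟩
  rw [← mem_closure_iff_nhdsWithin_neBot, Metric.mem_closure_iff]
  intro ε hε
  obtain ⟨n, hn⟩ := exists_pow_mul_lt hK (Metric.diam (Set.univ : Set Z)) hε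
  obtain ⟨g, hg, hginj, hmap, y, hy, rfl⟩ :=
    hX.exists_composition (fun j => (hf j).toLipschitzWith) n hx
  obtain ⟨z, hz, hzy⟩ := hnt.exists_ne y
  exact ⟨⟨g z, hmap X hX.mapsTo hz⟩, fun h => hzy (hginj hinj (congrArg Subtype.val h)),
    (hg.dist_le_mul_diam_univ y z).trans_lt hn⟩

/-- Every fixed point lies in `X`, so a one-point `X` would force all of them to coincide. -/
theorem IsSelfSimilarCompact.nontrivial [CompactSpace Z] [Nonempty Z] {X : Set Z}
    (hX : IsSelfSimilarCompact f X) (j₀ : Fin m) (hf : ∀ j, ContractingWith K (f j))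
    (hfix : ¬ ∃ p : Z, ⋃ j, {z : Z | f j z = z} = {p}) : X.Nontrivial := by
  by_contra h
  rw [Set.not_nontrivial_iff] at h
  have hmem : ∀ j, (hf j).fixedPoint (f j) ∈ X := fun j =>
    (hf j).fixedPoint_mem_of_isClosed hX.2.1.isClosed hX.1 (hX.mapsTo j)
  refine hfix ⟨(hf j₀).fixedPoint (f j₀), Set.ext fun z => ?_⟩
  simp only [Set.mem_iUnion, Set.mem_ofPred_eq, Set.mem_singleton_iff]
  constructor
  · rintro ⟨j, hz⟩
    rw [(hf j).fixedPoint_unique hz]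
    exact h (hmem j) (hmem j₀)
  · rintro rfl
    exact ⟨j₀, (hf j₀).fixedPoint_isFixedPt⟩

/-- The attractor is a finite union of sets of arbitrarily small diameter. -/
theorem IsSelfSimilarCompact.exists_cover_ediam_le {X : Set Z} (hX : IsSelfSimilarCompact f X)
    (hf : ∀ j, LipschitzWith K (f j)) (n : ℕ) :
    ∃ (ι : Type) (_ : Fintype ι) (A : ι → Set Z), ⋃ i, A i = X ∧
      ∀ i, Metric.ediam (A i) ≤ (K : ENNReal) ^ n * Metric.ediam X := by
  induction n with
  | zero => exact ⟨Unit, inferInstance, fun _ => X, Set.iUnion_const X, by simp⟩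
  | succ n ih =>
    obtain ⟨ι, _, A, hA, hd⟩ := ih
    refine ⟨Fin m × ι, inferInstance, fun p => f p.1 '' A p.2, ?_, fun p => ?_⟩
    · rw [Set.iUnion_prod']
      simp_rw [← Set.image_iUnion, hA]
      exact hX.2.2
    · calc Metric.ediam (f p.1 '' A p.2) ≤ K * Metric.ediam (A p.2) :=
            (hf p.1).ediam_image_le _
        _ ≤ K * ((K : ENNReal) ^ n * Metric.ediam X) := by gcongr; exact hd _
        _ = _ := by rw [pow_succ', mul_assoc]

/-- If the maps have Lipschitz constants `c j` at scale `δ`, a cover of the attractor by sets of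
diameter less than `δ` can be refined so that the total diameter decays like `(∑ j, c j) ^ n`. -/
theorem IsSelfSimilarCompact.exists_cover_sum_ediam_le {X : Set Z}
    (hX : IsSelfSimilarCompact f X) (hf : ∀ j, LipschitzWith K (f j)) (hK : K ≤ 1)
    {δ : ENNReal} {c : Fin m → NNReal}
    (hc : ∀ j z z', edist z z' < δ → edist (f j z) (f j z') ≤ c j * edist z z')
    {ι : Type} [Fintype ι] {A : ι → Set Z} (hA : ⋃ i, A i = X)
    (hd : ∀ i, Metric.ediam (A i) < δ) (n : ℕ) :
    ∃ (κ : Type) (_ : Fintype κ) (B : κ → Set Z), ⋃ i, B i = X ∧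
      (∀ i, Metric.ediam (B i) < δ) ∧
      ∑ i, Metric.ediam (B i) ≤ ((∑ j, c j : NNReal) : ENNReal) ^ n * ∑ i, Metric.ediam (A i) := by
  induction n with
  | zero => exact ⟨ι, inferInstance, A, hA, hd, by simp⟩
  | succ n ih =>
    obtain ⟨κ, _, B, hB, hdB, hs⟩ := ih
    refine ⟨Fin m × κ, inferInstance, fun p => f p.1 '' B p.2, ?_, fun p => ?_, ?_⟩
    · rw [Set.iUnion_prod']
      simp_rw [← Set.image_iUnion, hB]
      exact hX.2.2
    -- Pieces never grow, so `hc` remains applicable at the next refinement.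
    · refine (((hf p.1).ediam_image_le _).trans ?_).trans_lt (hdB p.2)
      exact mul_le_of_le_one_left' (by exact_mod_cast hK)
    · have hstep : ∀ p : Fin m × κ,
          Metric.ediam (f p.1 '' B p.2) ≤ c p.1 * Metric.ediam (B p.2) := by
        intro p
        refine Metric.ediam_le ?_
        rintro _ ⟨x, hx, rfl⟩ _ ⟨y, hy, rfl⟩
        have hxy := Metric.edist_le_ediam_of_mem hx hy
        exact (hc _ _ _ (hxy.trans_lt (hdB p.2))).trans (by gcongr)
      calc ∑ p : Fin m × κ, Metric.ediam (f p.1 '' B p.2)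
          ≤ ∑ p : Fin m × κ, c p.1 * Metric.ediam (B p.2) :=
            Finset.sum_le_sum fun p _ => hstep p
        _ = ((∑ j, c j : NNReal) : ENNReal) * ∑ i, Metric.ediam (B i) := by
            rw [Fintype.sum_prod_type, ENNReal.ofNNReal_finsetSum, Finset.sum_mul_sum]
        _ ≤ ((∑ j, c j : NNReal) : ENNReal) *
              (((∑ j, c j : NNReal) : ENNReal) ^ n * ∑ i, Metric.ediam (A i)) := by gcongr
        _ = _ := by rw [pow_succ', mul_assoc]

/-- A metric space all of whose distance functions have null range is zero-dimensional. -/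
theorem isZeroDimensional_of_volume_range_dist {Y : Type*} [PseudoMetricSpace Y]
    (h : ∀ p : Y, volume (Set.range (dist p)) = 0) : IsZeroDimensional Y := by
  intro p U hU hp
  obtain ⟨ε, hε, hball⟩ := Metric.isOpen_iff.1 hU p hp
  -- A null set cannot contain an interval; the sphere of an omitted radius is empty.
  obtain ⟨r, ⟨hr0, hrε⟩, hr⟩ : ∃ r ∈ Set.Ioo 0 ε, r ∉ Set.range (dist p) := by
    by_contra! hcon
    have := measure_mono_null (μ := volume) (show Set.Ioo 0 ε ⊆ Set.range (dist p) from hcon) (h p)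
    rw [Real.volume_Ioo, sub_zero, ENNReal.ofReal_eq_zero] at this
    exact absurd hε this.not_gt
  have heq : Metric.ball p r = Metric.closedBall p r := by
    refine Metric.ball_subset_closedBall.antisymm fun x hx => ?_
    rw [Metric.mem_closedBall, dist_comm] at hx
    rw [Metric.mem_ball, dist_comm]
    exact lt_of_le_of_ne hx fun hxr => hr ⟨x, hxr⟩
  exact ⟨Metric.ball p r, ⟨heq ▸ Metric.isClosed_closedBall, Metric.isOpen_ball⟩,
    Metric.mem_ball_self hr0, (Metric.ball_subset_ball hrε.le).trans hball⟩

/-- Since `dist p` is 1-Lipschitz, the total diameter of any cover bounds the measure of its range.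
-/
theorem IsSelfSimilarCompact.isZeroDimensional {X : Set Z} (hX : IsSelfSimilarCompact f X)
    (hf : ∀ j, ContractingWith K (f j)) (hK : K < 1) {δ : ENNReal} (hδ : 0 < δ)
    {c : Fin m → NNReal}
    (hc : ∀ j z z', edist z z' < δ → edist (f j z) (f j z') ≤ c j * edist z z')
    (hsum : ∑ j, c j < 1) : IsZeroDimensional X := by
  have hlip := fun j => (hf j).toLipschitzWith
  have hXtop : Metric.ediam X ≠ ⊤ := hX.2.1.isBounded.ediam_ne_top
  obtain ⟨n, hn⟩ : ∃ n : ℕ, (K : ENNReal) ^ n * Metric.ediam X < δ := by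
    have h := ENNReal.Tendsto.mul_const (b := Metric.ediam X)
      (ENNReal.tendsto_pow_atTop_nhds_zero_of_lt_one
        (show (K : ENNReal) < 1 by exact_mod_cast hK)) (Or.inr hXtop)
    rw [zero_mul] at h
    exact (h.eventually_lt_const hδ).exists
  obtain ⟨ι, _, A, hA, hd⟩ := hX.exists_cover_ediam_le hlip n
  have hStop : ∑ i, Metric.ediam (A i) ≠ ⊤ := ENNReal.sum_ne_top.2 fun i _ =>
    ne_top_of_le_ne_top hXtop (Metric.ediam_mono (hA ▸ Set.subset_iUnion A i))
  refine isZeroDimensional_of_volume_range_dist fun p => ?_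
  have hrange : Set.range (dist p) = dist (p : Z) '' X := by
    ext r
    simp [Subtype.dist_eq]
  have hle : ∀ k : ℕ, volume (Set.range (dist p)) ≤
      ((∑ j, c j : NNReal) : ENNReal) ^ k * ∑ i, Metric.ediam (A i) := by
    intro k
    obtain ⟨κ, _, B, hB, -, hs⟩ :=
      hX.exists_cover_sum_ediam_le hlip hK.le hc hA (fun i => (hd i).trans_lt hn) k
    calc volume (Set.range (dist p)) = volume (⋃ i, dist (p : Z) '' B i) := by
          rw [hrange, ← Set.image_iUnion, hB]
      _ ≤ ∑ i, volume (dist (p : Z) '' B i) := measure_iUnion_fintype_le _ _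
      _ ≤ ∑ i, Metric.ediam (B i) := Finset.sum_le_sum fun i _ =>
          (Real.volume_le_diam _).trans (by
            simpa using (LipschitzWith.dist_right (p : Z)).ediam_image_le (B i))
      _ ≤ _ := hs
  have hlim := ENNReal.Tendsto.mul_const (b := ∑ i, Metric.ediam (A i))
    (ENNReal.tendsto_pow_atTop_nhds_zero_of_lt_one
      (show ((∑ j, c j : NNReal) : ENNReal) < 1 by exact_mod_cast hsum)) (Or.inr hStop)
  rw [zero_mul] at hlim
  exact le_antisymm (ge_of_tendsto' hlim hle) zero_le

end IteratedFunctionSystem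

/-- If the infima of finitely many families sum to less than `1`, so do suitable values. -/
theorem exists_sum_lt_of_sum_iInf_lt {ι S : Type*} [Fintype ι] [Nonempty ι] [Nonempty S]
    {a : ι → S → ℝ} {b : ℝ} (h : ∑ j, ⨅ s, a j s < b) : ∃ s : ι → S, ∑ j, a j (s j) < b := by
  have hcard : (0 : ℝ) < Fintype.card ι := by exact_mod_cast Fintype.card_pos
  set ε : ℝ := (b - ∑ j, ⨅ s, a j s) / Fintype.card ι with hε
  have hεpos : 0 < ε := div_pos (sub_pos.2 h) hcard
  have hex : ∀ j, ∃ s, a j s < (⨅ s, a j s) + ε := fun j =>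
    exists_lt_of_ciInf_lt (lt_add_of_pos_right _ hεpos)
  choose s hs using hex
  refine ⟨s, (Finset.sum_lt_sum_of_nonempty Finset.univ_nonempty fun j _ => hs j).trans_le ?_⟩
  rw [Finset.sum_add_distrib, Finset.sum_const, Finset.card_univ, nsmul_eq_mul, hε,
    mul_div_cancel₀ _ hcard.ne']
  linarith

theorem mainTheorem3 {Z : Type*} [MetricSpace Z] [CompactSpace Z] [Nonempty Z]
    (m : ℕ) (hm : 2 ≤ m) (f : Fin m → Z → Z) (α : Fin m → ℝ → ℝ)
    (hα : ∀ j, ∀ η > 0, 0 < α j η ∧ α j η < 1)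
    (hinf : ∀ j, 0 < ⨅ η : Set.Ioi (0 : ℝ), α j η)
    (hf : ∀ j, ∀ η > 0, ∀ z z' : Z, dist z z' < η → dist (f j z) (f j z') ≤ α j η * dist z z') :
    ∃ X : Set Z, IsSelfSimilarCompact f X ∧
      (∀ Y : Set Z, IsSelfSimilarCompact f Y → Y = X) ∧
      ((∀ j, Function.Injective (f j)) →
        (¬ ∃ p : Z, ⋃ j, {z : Z | f j z = z} = {p}) →
          PerfectSpace X ∧
          ((∑ j, ⨅ η : Set.Ioi (0 : ℝ), α j η) < 1 → IsZeroDimensional X)) := by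
  have j₀ : Fin m := ⟨0, by omega⟩
  have : Nonempty (Fin m) := ⟨j₀⟩
  -- The `+ 1` makes `dist z z' < D` strict for all pairs.
  let D : ℝ := Metric.diam (Set.univ : Set Z) + 1
  have hDpos : 0 < D := add_pos_of_nonneg_of_pos Metric.diam_nonneg one_pos
  have hdist : ∀ z z' : Z, dist z z' < D := fun z z' =>
    (Metric.dist_le_diam_of_mem isCompact_univ.isBounded trivial trivial).trans_lt
      (lt_add_one _)
  obtain ⟨i, hi⟩ := Finite.exists_max fun j => α j D
  let K : NNReal := ⟨α i D, (hα i D hDpos).1.le⟩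
  have hK : K < 1 := NNReal.coe_lt_coe.1 (hα i D hDpos).2
  have hcon : ∀ j, ContractingWith K (f j) := fun j =>
    ⟨hK, LipschitzWith.of_dist_le_mul fun z z' => (hf j D hDpos z z' (hdist z z')).trans
      (mul_le_mul_of_nonneg_right (hi j) dist_nonneg)⟩
  obtain ⟨X, hX⟩ := exists_isSelfSimilarCompact j₀ hcon
  refine ⟨X, hX, fun Y hY => (hY.subset hX hcon hK).antisymm (hX.subset hY hcon hK),
    fun hinj hfix => ⟨hX.perfectSpace (hX.nontrivial j₀ hcon hfix) hcon hK hinj, fun hsum => ?_⟩⟩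
  have : Nonempty (Set.Ioi (0 : ℝ)) := ⟨⟨1, Set.mem_Ioi.2 one_pos⟩⟩
  obtain ⟨η, hη⟩ := exists_sum_lt_of_sum_iInf_lt hsum
  -- Below the smallest chosen scale, all the chosen bounds hold at once.
  obtain ⟨k, hk⟩ := Finite.exists_min fun j => (η j : ℝ)
  have hηpos : ∀ j, 0 < (η j : ℝ) := fun j => (η j).2
  let c : Fin m → NNReal := fun j => ⟨α j (η j), (hα j _ (hηpos j)).1.le⟩
  refine hX.isZeroDimensional hcon hK (δ := ENNReal.ofReal (η k)) (c := c)
    (ENNReal.ofReal_pos.2 (hηpos k)) (fun j z z' h => ?_) ?_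
  · rw [edist_dist, ENNReal.ofReal_lt_ofReal_iff (hηpos k)] at h
    rw [edist_dist, edist_dist, ← ENNReal.ofReal_coe_nnreal,
      ← ENNReal.ofReal_mul (c j).coe_nonneg]
    exact ENNReal.ofReal_le_ofReal (hf j _ (hηpos j) z z' (h.trans_le (hk j)))
  · rw [← NNReal.coe_lt_coe, NNReal.coe_sum]
    exact hη
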